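/- Let $\Omega\subset\mathbb{R}^n$ ($n\ge 1$) be a bounded open convex polytopal set, and let $\mathcal{L}w=-\operatorname{div}(A\nabla w)+cw$ with homogeneous Dirichlet boundary conditions, where $A$ is a symmetric, uniformly positive definite matrix field that is Lipschitz on $\Omega$, and $0\le c\in L^\infty(\Omega)$. Let $(\lambda_k,\varphi_k)_{k}$ be the eigenpairs of $\mathcal{L}$ (in the weak sense, $\varphi_k\in H^1_0(\Omega)$), with $(\varphi_k)$ an orthonormal basis of $L^2(\Omega)$ and $\lambda_k>0$, and write $w_k=\int_\Omega w\varphi_k$. For $s\in(0,1)$ put $$\mathbb{H}^s(\Omega)=\Big\{w=\sum_k w_k\varphi_k\in L^2(\Omega):\ \sum_k\lambda_k^s|w_k|^2<\infty\Big\},\qquad \mathcal{L}^s w=\sum_k\lambda_k^s w_k\varphi_k ,$$ where $\mathcal{L}^s w$ is understood as the element $v\mapsto\sum_k\lambda_k^s w_kv_k$ of the dual of $\mathbb{H}^s(\Omega)$. Let $a<0<b$, $\sigma,\nu>0$ and $u_d\in L^2(\Omega)$ be given, and set $Z_{ad}=\{z\in L^2(\Omega): a\le z\le b \text{ a.e.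 in }\Omega\}$ and $$J(u,z)=\tfrac12\|u-u_d\|_{L^2(\Omega)}^2+\tfrac{\sigma}{2}\|z\|_{L^2(\Omega)}^2+\nu\|z\|_{L^1(\Omega)} .$$ **Theorem.** There is exactly one pair $(\bar u,\bar z)\in\mathbb{H}^s(\Omega)\times Z_{ad}$ with $\mathcal{L}^s\bar u=\bar z$ such that $J(\bar u,\bar z)\le J(u,z)$ for all $(u,z)\in\mathbb{H}^s(\Omega)\times Z_{ad}$ with $\mathcal{L}^s u=z$. -/

import Mathlib

open MeasureTheory
open scoped ContDiff ENNReal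

noncomputable section

namespace FracControl

/-- Euclidean space `ℝⁿ`. -/
abbrev E (n : ℕ) : Type := EuclideanSpace ℝ (Fin n)

/-- The real Hilbert space `L²(Ω)`. -/
abbrev L2 {n : ℕ} (Ω : Set (E n)) : Type := Lp ℝ 2 (volume.restrict Ω)

/-- The Hilbert space `L²(Ω; ℝⁿ)` of square integrable vector fields. -/
abbrev L2Vec {n : ℕ} (Ω : Set (E n)) : Type := Lp (E n) 2 (volume.restrict Ω)

/-- A bounded open convex polytopal set: the interior of the convex hull of finitely many points. -/
def IsOpenConvexPolytope {n : ℕ} (Ω : Set (E n)) : Prop :=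
  ∃ F : Finset (E n), Ω = interior (convexHull ℝ (F : Set (E n)))

/-- Assumptions on the coefficients of `ℒ w = -div (A ∇w) + c w`: the matrix field `A` is Lipschitz
on `Ω`, symmetric and uniformly positive definite, and `0 ≤ c ∈ L^∞(Ω)`. -/
structure IsEllipticCoeff {n : ℕ} (Ω : Set (E n)) (A : E n → Matrix (Fin n) (Fin n) ℝ)
    (c : E n → ℝ) : Prop where
  lipschitz : ∀ i j, ∃ K, LipschitzOnWith K (fun x => A x i j) Ω
  symm : ∀ x ∈ Ω, (A x).IsSymm
  elliptic : ∃ α : ℝ, 0 < α ∧ ∀ x ∈ Ω, ∀ ξ : E n,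
    α * ‖ξ‖ ^ 2 ≤ ∑ i, ∑ j, A x i j * ξ j * ξ i
  bounded : MemLp c ∞ (volume.restrict Ω)
  nonneg : ∀ᵐ x ∂(volume.restrict Ω), 0 ≤ c x

/-- The pairs `(φ, ∇φ)` with `φ ∈ C_c^∞(Ω)`. -/
def testPairs {n : ℕ} (Ω : Set (E n)) : Set (L2 Ω × L2Vec Ω) :=
  {p | ∃ φ : E n → ℝ, ContDiff ℝ ∞ φ ∧ HasCompactSupport φ ∧ tsupport φ ⊆ Ω ∧
    (p.1 : E n → ℝ) =ᵐ[volume.restrict Ω] φ ∧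
    (p.2 : E n → E n) =ᵐ[volume.restrict Ω] fun x => gradient φ x}

/-- The space `H₀¹(Ω)`, the closure of `C_c^∞(Ω)` in the `H¹` norm, with each element `u` given
together with its weak gradient: the set of pairs `(u, ∇u)`. -/
def H10 {n : ℕ} (Ω : Set (E n)) : Set (L2 Ω × L2Vec Ω) :=
  closure (testPairs Ω)

/-- The bilinear form `∫_Ω A ∇u · ∇v + c u v` of `ℒ`, on pairs `p = (u, ∇u)`, `q = (v, ∇v)`. -/
def energyForm {n : ℕ} (Ω : Set (E n)) (A : E n → Matrix (Fin n) (Fin n) ℝ) (c : E n → ℝ)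
    (p q : L2 Ω × L2Vec Ω) : ℝ :=
  ∫ x in Ω, ((∑ i, ∑ j, A x i j * p.2 x j * q.2 x i) + c x * p.1 x * q.1 x)

/-- `φ ∈ H₀¹(Ω)` is a weak solution of `ℒ φ = μ φ` in `Ω`, `φ = 0` on `∂Ω`. -/
def IsEigenfunction {n : ℕ} (Ω : Set (E n)) (A : E n → Matrix (Fin n) (Fin n) ℝ) (c : E n → ℝ)
    (μ : ℝ) (φ : L2 Ω) : Prop :=
  ∃ G : L2Vec Ω, (φ, G) ∈ H10 Ω ∧
    ∀ q ∈ H10 Ω, energyForm Ω A c (φ, G) q = μ * inner ℝ φ q.1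

/-- The eigenspace of `ℒ` in `L²(Ω)` for the eigenvalue `μ`. (For elliptic coefficients the
eigenfunctions already form a closed subspace; the closed span makes this hold by construction,
whatever the coefficients are.) -/
def eigenspace {n : ℕ} (Ω : Set (E n)) (A : E n → Matrix (Fin n) (Fin n) ℝ) (c : E n → ℝ)
    (μ : ℝ) : Submodule ℝ (L2 Ω) :=
  (Submodule.span ℝ {φ | IsEigenfunction Ω A c μ φ}).topologicalClosure

instance completeSpace_eigenspace {n : ℕ} (Ω : Set (E n))
    (A : E n → Matrix (Fin n) (Fin n) ℝ) (c : E n → ℝ) (μ : ℝ) :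
    CompleteSpace (eigenspace Ω A c μ) :=
  (Submodule.isClosed_topologicalClosure _).completeSpace_coe

/-- The `L²(Ω)`-orthogonal projection of `w` onto the eigenspace for `μ`; in terms of an
orthonormal basis `φ_k` of eigenfunctions with eigenvalues `μ_k`, it is the sum of the terms
`w_k φ_k`, `w_k = ∫_Ω w φ_k`, over the indices `k` with `μ_k = μ`. -/
def eigenproj {n : ℕ} (Ω : Set (E n)) (A : E n → Matrix (Fin n) (Fin n) ℝ) (c : E n → ℝ)
    (μ : ℝ) (w : L2 Ω) : L2 Ω :=
  (eigenspace Ω A c μ).starProjection w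

/-- The fractional space `ℍ^s(Ω)`: those `w ∈ L²(Ω)` that are the sum of their eigenfunction
expansion and satisfy `∑ μ_k^s |w_k|² < ∞`. The eigenvalues of `ℒ` are positive. -/
def fracSpace {n : ℕ} (Ω : Set (E n)) (A : E n → Matrix (Fin n) (Fin n) ℝ) (c : E n → ℝ)
    (s : ℝ) : Set (L2 Ω) :=
  {w | HasSum (fun μ : Set.Ioi (0 : ℝ) => eigenproj Ω A c μ w) w ∧
    Summable (fun μ : Set.Ioi (0 : ℝ) => (μ : ℝ) ^ s * ‖eigenproj Ω A c μ w‖ ^ 2)}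

/-- `u ∈ ℍ^s(Ω)` solves `ℒ^s u = z` in `Ω`. Here `ℒ^s u = ∑ μ_k^s u_k φ_k` is the element
`v ↦ ∑ μ_k^s u_k v_k` of the dual `ℍ^{-s}(Ω)` of `ℍ^s(Ω)`, and `z ∈ L²(Ω)` is identified with the
functional `v ↦ ∫_Ω z v`. -/
def IsState {n : ℕ} (Ω : Set (E n)) (A : E n → Matrix (Fin n) (Fin n) ℝ) (c : E n → ℝ)
    (s : ℝ) (z u : L2 Ω) : Prop :=
  u ∈ fracSpace Ω A c s ∧ ∀ v ∈ fracSpace Ω A c s,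
    HasSum (fun μ : Set.Ioi (0 : ℝ) =>
      (μ : ℝ) ^ s * inner ℝ (eigenproj Ω A c μ u) (eigenproj Ω A c μ v)) (inner ℝ z v)

/-- The set `Z_ad` of admissible controls. -/
def admissible {n : ℕ} (Ω : Set (E n)) (a b : ℝ) : Set (L2 Ω) :=
  {z | ∀ᵐ x ∂(volume.restrict Ω), a ≤ z x ∧ z x ≤ b}

/-- The cost `J(u, z) = ½ ‖u - u_d‖²_{L²} + (σ/2) ‖z‖²_{L²} + ν ‖z‖_{L¹}`. -/
def cost {n : ℕ} (Ω : Set (E n)) (σ ν : ℝ) (ud u z : L2 Ω) : ℝ :=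
  1 / 2 * ‖u - ud‖ ^ 2 + σ / 2 * ‖z‖ ^ 2 + ν * ∫ x in Ω, |z x|

/-- The state–control pair `(u, z)` is optimal: `z ∈ Z_ad`, `u ∈ ℍ^s(Ω)` is the state of `z`, and
`J(u, z) ≤ J(u', z')` for every `z' ∈ Z_ad` with state `u' ∈ ℍ^s(Ω)`. -/
def IsOptimalPair {n : ℕ} (Ω : Set (E n)) (A : E n → Matrix (Fin n) (Fin n) ℝ) (c : E n → ℝ)
    (s a b σ ν : ℝ) (ud u z : L2 Ω) : Prop :=
  z ∈ admissible Ω a b ∧ IsState Ω A c s z u ∧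
    ∀ u' z' : L2 Ω, z' ∈ admissible Ω a b → IsState Ω A c s z' u' →
      cost Ω σ ν ud u z ≤ cost Ω σ ν ud u' z'

end FracControl

end

/-! The state equation has a bounded linear solution operator `S`, so the problem reduces to
minimizing `z ↦ J(S z, z)` over the closed convex set of admissible controls. The tracking and L¹
terms are convex and the term `σ/2 * ‖z‖ ^ 2` is uniformly convex, so every minimizing sequence is
Cauchy and the minimizer is unique (`existsUnique_minimizer_of_midpoint`).

The operator is `S z = ∑ μ^(-s) P_μ z`, with `P_μ` the projection onto the eigenspace of `μ`.
Symmetry of the form makes eigenspaces orthogonal, and Poincaré's inequality with ellipticity bounds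
the eigenvalues below by some `δ > 0`, so the multipliers are at most `δ^(-s)`
(`exists_solutionOperator`). Completeness of the eigenfunctions is never needed: elements of the
fractional space are sums of their own projections, so a part of `z` orthogonal to all eigenspaces
is invisible to the test functions. -/

namespace FracControl

/-! ### Uniformly convex minimization and orthogonal families in Hilbert space. -/

section Abstract

variable {H : Type*} [NormedAddCommGroup H] [InnerProductSpace ℝ H]

/-- Minimizers of a nonnegative continuous function with a quadratic midpoint gap. -/
theorem existsUnique_minimizer_of_midpoint [CompleteSpace H] {K : Set H} (hne : K.Nonempty)
    (hcl : IsClosed K) (hmid : ∀ x ∈ K, ∀ y ∈ K, (1 / 2 : ℝ) • (x + y) ∈ K)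
    {j : H → ℝ} (hj : Continuous j) (hj0 : ∀ x, 0 ≤ j x) {κ : ℝ} (hκ : 0 < κ)
    (hconv : ∀ x y, j ((1 / 2 : ℝ) • (x + y)) + κ * ‖x - y‖ ^ 2 ≤ (j x + j y) / 2) :
    ∃! z, z ∈ K ∧ ∀ y ∈ K, j z ≤ j y := by
  have hbdd : BddBelow (j '' K) := ⟨0, by rintro _ ⟨x, -, rfl⟩; exact hj0 x⟩
  set m := sInf (j '' K) with hm
  have hle : ∀ y ∈ K, m ≤ j y := fun y hy => csInf_le hbdd ⟨y, hy, rfl⟩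
  -- The midpoint has value at least `m`, so near-minimizers are close together; this gives both the
  -- Cauchy property and uniqueness.
  have key : ∀ x ∈ K, ∀ y ∈ K, κ * ‖x - y‖ ^ 2 ≤ (j x - m) / 2 + (j y - m) / 2 := by
    intro x hx y hy
    have h1 := hle _ (hmid x hx y hy)
    have h2 := hconv x y
    linarith
  have hex : ∀ k : ℕ, ∃ x ∈ K, j x < m + 1 / (k + 1 : ℝ) := by
    intro k
    have : m < m + 1 / (k + 1 : ℝ) := by have : (0 : ℝ) < 1 / (k + 1 : ℝ) := by positivity
                                         linarith
    obtain ⟨_, ⟨x, hx, rfl⟩, hlt⟩ := exists_lt_of_csInf_lt (hne.image j) this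
    exact ⟨x, hx, hlt⟩
  choose x hxK hx using hex
  have hcau : CauchySeq x := by
    rw [Metric.cauchySeq_iff']
    intro ε hε
    obtain ⟨N, hN⟩ := exists_nat_one_div_lt (show 0 < κ * ε ^ 2 by positivity)
    refine ⟨N, fun k hk => ?_⟩
    rw [dist_eq_norm]
    have h1 := key _ (hxK k) _ (hxK N)
    have h2 := hx k
    have h3 := hx N
    have h4 : 1 / ((k : ℝ) + 1) ≤ 1 / ((N : ℝ) + 1) := Nat.one_div_le_one_div hk
    have h5 : κ * ‖x k - x N‖ ^ 2 < κ * ε ^ 2 := by linarith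
    exact lt_of_pow_lt_pow_left₀ 2 hε.le (lt_of_mul_lt_mul_left h5 hκ.le)
  obtain ⟨z, hz⟩ := cauchySeq_tendsto_of_complete hcau
  have hzK : z ∈ K := hcl.mem_of_tendsto hz (Filter.Eventually.of_forall hxK)
  have hzm : j z ≤ m := by
    have h1 : Filter.Tendsto (fun k => j (x k)) Filter.atTop (nhds (j z)) :=
      (hj.tendsto z).comp hz
    have h2 : Filter.Tendsto (fun k : ℕ => m + 1 / (k + 1 : ℝ)) Filter.atTop (nhds (m + 0)) :=
      tendsto_const_nhds.add tendsto_one_div_add_atTop_nhds_zero_nat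
    simpa using le_of_tendsto_of_tendsto' h1 h2 fun k => (hx k).le
  refine ⟨z, ⟨hzK, fun y hy => hzm.trans (hle y hy)⟩, ?_⟩
  rintro y ⟨hyK, hy⟩
  have h1 := key y hyK z hzK
  have h2 : j y ≤ m := (hy z hzK).trans hzm
  have h3 : κ * ‖y - z‖ ^ 2 ≤ 0 := by linarith
  have h4 : ‖y - z‖ ^ 2 ≤ 0 := by
    by_contra h
    have := mul_pos hκ (not_le.1 h)
    linarith
  have h5 : ‖y - z‖ = 0 := by nlinarith [norm_nonneg (y - z)]
  exact sub_eq_zero.1 (norm_eq_zero.1 h5)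

theorem norm_sq_midpoint (x y : H) :
    ‖(1 / 2 : ℝ) • (x + y)‖ ^ 2 + 1 / 4 * ‖x - y‖ ^ 2 = (‖x‖ ^ 2 + ‖y‖ ^ 2) / 2 := by
  have h := parallelogram_law_with_norm ℝ x y
  rw [norm_smul, Real.norm_of_nonneg (by norm_num)]
  nlinarith

variable {ι : Type*} {V : ι → Submodule ℝ H}

theorem starProjection_eq_zero_of_isOrtho {U W : Submodule ℝ H} [U.HasOrthogonalProjection]
    (h : U ⟂ W) {w : H} (hw : w ∈ W) : U.starProjection w = 0 :=
  (Submodule.starProjection_apply_eq_zero_iff _).2 (h.symm hw)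

theorem inner_starProjection_starProjection (U : Submodule ℝ H) [U.HasOrthogonalProjection]
    (z v : H) : inner ℝ (U.starProjection z) (U.starProjection v) = inner ℝ z (U.starProjection v) := by
  rw [Submodule.inner_starProjection_left_eq_right,
    Submodule.starProjection_eq_self_iff.2 (Submodule.starProjection_apply_mem _ v)]

theorem norm_sum_sq_of_pairwise_isOrtho (hV : Pairwise fun i k => V i ⟂ V k) {f : ι → H}
    (hf : ∀ i, f i ∈ V i) (F : Finset ι) : ‖∑ i ∈ F, f i‖ ^ 2 = ∑ i ∈ F, ‖f i‖ ^ 2 :=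
  (OrthogonalFamily.of_pairwise hV).norm_sum (fun i => (⟨f i, hf i⟩ : V i)) F

theorem summable_of_pairwise_isOrtho [CompleteSpace H] (hV : Pairwise fun i k => V i ⟂ V k)
    {f : ι → H} (hf : ∀ i, f i ∈ V i) (hs : Summable fun i => ‖f i‖ ^ 2) : Summable f :=
  ((OrthogonalFamily.of_pairwise hV).summable_iff_norm_sq_summable
    (fun i => (⟨f i, hf i⟩ : V i))).2 hs

variable [∀ i, (V i).HasOrthogonalProjection]

/-- The projection of a sum of elements of pairwise orthogonal subspaces. -/
theorem starProjection_of_hasSum (hV : Pairwise fun i k => V i ⟂ V k) {f : ι → H}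
    (hf : ∀ i, f i ∈ V i) {w : H} (hw : HasSum f w) (i : ι) : (V i).starProjection w = f i := by
  have h1 : HasSum (fun k => (V i).starProjection (f k)) ((V i).starProjection w) :=
    hw.mapL _
  have h2 : HasSum (fun k => (V i).starProjection (f k)) ((V i).starProjection (f i)) :=
    hasSum_single i fun k hk => starProjection_eq_zero_of_isOrtho (hV hk.symm) (hf k)
  rw [h1.unique h2]
  exact Submodule.starProjection_eq_self_iff.2 (hf i)

/-- Bessel's inequality for orthogonal subspaces. -/
theorem sum_norm_starProjection_sq_le (hV : Pairwise fun i k => V i ⟂ V k) (z : H)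
    (F : Finset ι) : ∑ i ∈ F, ‖(V i).starProjection z‖ ^ 2 ≤ ‖z‖ ^ 2 := by
  set S := ∑ i ∈ F, (V i).starProjection z with hS
  have h1 : ‖S‖ ^ 2 = ∑ i ∈ F, ‖(V i).starProjection z‖ ^ 2 :=
    norm_sum_sq_of_pairwise_isOrtho hV (fun i => Submodule.starProjection_apply_mem _ z) F
  have h2 : inner ℝ S z = ∑ i ∈ F, ‖(V i).starProjection z‖ ^ 2 := by
    rw [hS, sum_inner]
    refine Finset.sum_congr rfl fun i _ => ?_
    rw [real_inner_comm, ← real_inner_self_eq_norm_sq, inner_starProjection_starProjection]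
  have h3 := real_inner_le_norm S z
  rw [← h1] at h2 ⊢
  nlinarith [norm_nonneg S, norm_nonneg z, sq_nonneg (‖S‖ - ‖z‖)]

theorem summable_norm_starProjection_sq (hV : Pairwise fun i k => V i ⟂ V k) (z : H) :
    Summable fun i => ‖(V i).starProjection z‖ ^ 2 :=
  summable_of_sum_le (fun _ => sq_nonneg _) (sum_norm_starProjection_sq_le hV z)

/-- A spectral multiplier with coefficients bounded on the nontrivial subspaces. -/
theorem exists_multiplier [CompleteSpace H] (hV : Pairwise fun i k => V i ⟂ V k) (r : ι → ℝ)
    {C : ℝ} (hC : 0 ≤ C) (hr : ∀ i, V i ≠ ⊥ → |r i| ≤ C) :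
    ∃ S : H →L[ℝ] H, ∀ z, HasSum (fun i => r i • (V i).starProjection z) (S z) := by
  have hmem : ∀ z i, r i • (V i).starProjection z ∈ V i := fun z i =>
    (V i).smul_mem _ (Submodule.starProjection_apply_mem _ z)
  have hle : ∀ z i, ‖r i • (V i).starProjection z‖ ^ 2 ≤ C ^ 2 * ‖(V i).starProjection z‖ ^ 2 := by
    intro z i
    -- On a trivial subspace `r i` is uncontrolled, but the projection vanishes.
    by_cases h : V i = ⊥
    · have : (V i).starProjection z = 0 := by
        exact (Submodule.mem_bot ℝ).1 (h.le (Submodule.starProjection_apply_mem (V i) z))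
      simp [this]
    · rw [norm_smul, mul_pow, Real.norm_eq_abs]
      gcongr
      exact hr i h
  have hs : ∀ z, Summable fun i => r i • (V i).starProjection z := fun z =>
    summable_of_pairwise_isOrtho hV (hmem z) <|
      ((summable_norm_starProjection_sq hV z).mul_left _).of_nonneg_of_le
        (fun _ => sq_nonneg _) (hle z)
  let T : H →ₗ[ℝ] H :=
    { toFun := fun z => ∑' i, r i • (V i).starProjection z
      map_add' := fun x y => by
        rw [← (hs x).tsum_add (hs y)]
        simp
      map_smul' := fun t x => by
        rw [RingHom.id_apply, ← (hs x).tsum_const_smul t]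
        exact tsum_congr fun i => by rw [map_smul, smul_comm] }
  refine ⟨T.mkContinuous C fun z => ?_, fun z => (hs z).hasSum⟩
  have h1 : Filter.Tendsto (fun F : Finset ι => ‖∑ i ∈ F, r i • (V i).starProjection z‖)
      Filter.atTop (nhds ‖T z‖) := (hs z).hasSum.norm
  refine le_of_tendsto' h1 fun F => ?_
  refine abs_le_of_sq_le_sq' ?_ (by positivity) |>.2
  rw [norm_sum_sq_of_pairwise_isOrtho hV (hmem z), mul_pow]
  calc _ ≤ ∑ i ∈ F, C ^ 2 * ‖(V i).starProjection z‖ ^ 2 := Finset.sum_le_sum fun i _ => hle z i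
    _ = C ^ 2 * ∑ i ∈ F, ‖(V i).starProjection z‖ ^ 2 := by rw [Finset.mul_sum]
    _ ≤ _ := by gcongr; exact sum_norm_starProjection_sq_le hV z F

end Abstract

/-! ### The fractional equation for an abstract orthogonal family. -/

section Solution

variable {H : Type*} [NormedAddCommGroup H] [InnerProductSpace ℝ H] {ι : Type*}
  {V : ι → Submodule ℝ H} [∀ i, (V i).HasOrthogonalProjection]

/-- The fractional space of a family of orthogonal subspaces `V i` with weights `m i`. -/
def spectralSpace (V : ι → Submodule ℝ H) [∀ i, (V i).HasOrthogonalProjection] (m : ι → ℝ)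
    (s : ℝ) : Set H :=
  {w | HasSum (fun i => (V i).starProjection w) w ∧
    Summable fun i => m i ^ s * ‖(V i).starProjection w‖ ^ 2}

/-- `u` solves the fractional equation with right-hand side `z`. -/
def IsSpectralSolution (V : ι → Submodule ℝ H) [∀ i, (V i).HasOrthogonalProjection] (m : ι → ℝ)
    (s : ℝ) (z u : H) : Prop :=
  u ∈ spectralSpace V m s ∧ ∀ v ∈ spectralSpace V m s,
    HasSum (fun i => m i ^ s * inner ℝ ((V i).starProjection u) ((V i).starProjection v))
      (inner ℝ z v)

theorem mem_spectralSpace_of_mem (hV : Pairwise fun i k => V i ⟂ V k) (m : ι → ℝ) (s : ℝ) {i : ι}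
    {v : H} (hv : v ∈ V i) : v ∈ spectralSpace V m s := by
  have h0 : ∀ k, k ≠ i → (V k).starProjection v = 0 := fun k hk =>
    starProjection_eq_zero_of_isOrtho (hV hk) hv
  refine ⟨?_, summable_of_ne_finset_zero (s := {i}) fun k hk => ?_⟩
  · have := hasSum_single (f := fun k => (V k).starProjection v) i h0
    rwa [Submodule.starProjection_eq_self_iff.2 hv] at this
  · rw [h0 k (by simpa using hk)]
    simp

/-- Testing with an element of a single `V i` collapses the series to one term; the test element is
the residual of the `i`-th component, which is then orthogonal to itself. -/
theorem IsSpectralSolution.starProjection_eq (hV : Pairwise fun i k => V i ⟂ V k) {m : ι → ℝ}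
    (hm : ∀ i, 0 < m i) {s : ℝ} {z u : H} (h : IsSpectralSolution V m s z u) (i : ι) :
    (V i).starProjection u = m i ^ (-s) • (V i).starProjection z := by
  have hpos : 0 < m i ^ s := Real.rpow_pos_of_pos (hm i) s
  have hmem : ∀ x, (V i).starProjection x ∈ V i := Submodule.starProjection_apply_mem _
  have key : m i ^ s • (V i).starProjection u = (V i).starProjection z := by
    rw [← sub_eq_zero, ← inner_self_eq_zero (𝕜 := ℝ)]
    set v := m i ^ s • (V i).starProjection u - (V i).starProjection z with hv
    have hvi : v ∈ V i := (V i).sub_mem ((V i).smul_mem _ (hmem u)) (hmem z)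
    have hvv : (V i).starProjection v = v := Submodule.starProjection_eq_self_iff.2 hvi
    have h1 := h.2 v (mem_spectralSpace_of_mem hV m s hvi)
    have h2 := hasSum_single (f := fun k => m k ^ s *
      inner ℝ ((V k).starProjection u) ((V k).starProjection v)) i fun k hk => by
        rw [starProjection_eq_zero_of_isOrtho (hV hk) hvi, inner_zero_right, mul_zero]
    have h3 := h1.unique h2
    have h4 := inner_starProjection_starProjection (V i) z v
    rw [hvv] at h3 h4
    nth_rewrite 1 [hv]
    rw [inner_sub_left, real_inner_smul_left, h4, h3, sub_self]
  rw [← key, smul_smul, ← Real.rpow_add (hm i)]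
  simp

/-- Solvability of the fractional equation, with a bounded linear solution operator. -/
theorem exists_solutionOperator [CompleteSpace H] (hV : Pairwise fun i k => V i ⟂ V k) {m : ι → ℝ}
    (hm : ∀ i, 0 < m i) {δ : ℝ} (hδ : 0 < δ) (hmδ : ∀ i, V i ≠ ⊥ → δ ≤ m i) {s : ℝ} (hs : 0 ≤ s) :
    ∃ S : H →L[ℝ] H, ∀ z u, IsSpectralSolution V m s z u ↔ u = S z := by
  have hle : ∀ i, V i ≠ ⊥ → m i ^ (-s) ≤ δ ^ (-s) := fun i hi =>
    Real.rpow_le_rpow_of_nonpos hδ (hmδ i hi) (by linarith)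
  have hpos : ∀ i, 0 < m i ^ (-s) := fun i => Real.rpow_pos_of_pos (hm i) _
  have hδs : 0 < δ ^ (-s) := Real.rpow_pos_of_pos hδ _
  obtain ⟨S, hS⟩ := exists_multiplier hV (fun i => m i ^ (-s)) hδs.le fun i hi => by
    rw [abs_of_pos (hpos i)]; exact hle i hi
  have hproj : ∀ z i, (V i).starProjection (S z) = m i ^ (-s) • (V i).starProjection z :=
    fun z => starProjection_of_hasSum hV
      (fun i => (V i).smul_mem _ (Submodule.starProjection_apply_mem _ z)) (hS z)
  have hcancel : ∀ i, m i ^ s * m i ^ (-s) = 1 := fun i => by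
    rw [← Real.rpow_add (hm i)]; simp
  refine ⟨S, fun z u => ⟨fun h => ?_, ?_⟩⟩
  · refine h.1.1.unique ?_
    simpa only [h.starProjection_eq hV hm] using hS z
  · rintro rfl
    refine ⟨⟨?_, ?_⟩, fun v hv => ?_⟩
    · simpa only [hproj] using hS z
    · refine ((summable_norm_starProjection_sq hV z).mul_left (δ ^ (-s))).of_nonneg_of_le
        (fun i => mul_nonneg (Real.rpow_nonneg (hm i).le _) (sq_nonneg _)) fun i => ?_
      by_cases h : V i = ⊥
      · have h0 : ∀ x, (V i).starProjection x = 0 := fun x =>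
          (Submodule.mem_bot ℝ).1 (h.le (Submodule.starProjection_apply_mem (V i) x))
        simp [h0]
      -- One factor `m^(-s)` cancels the weight `m^s`; the other is at most `δ^(-s)`.
      · rw [hproj, norm_smul, Real.norm_of_nonneg (hpos i).le, mul_pow, ← mul_assoc, sq (m i ^ (-s)),
          ← mul_assoc, hcancel, one_mul]
        exact mul_le_mul_of_nonneg_right (hle i h) (sq_nonneg _)
    · have h1 : HasSum (fun i => inner ℝ z ((V i).starProjection v)) (inner ℝ z v) :=
        hv.1.mapL (innerSL ℝ z)
      have h2 : ∀ i, m i ^ s * inner ℝ ((V i).starProjection (S z)) ((V i).starProjection v) =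
          inner ℝ z ((V i).starProjection v) := fun i => by
        rw [hproj, real_inner_smul_left, ← mul_assoc, hcancel, one_mul,
          inner_starProjection_starProjection]
      simpa only [h2] using h1

end Solution

/-! ### Poincaré's inequality and the eigenspaces of the elliptic operator. -/

section Elliptic

variable {n : ℕ} {Ω : Set (E n)} {A : E n → Matrix (Fin n) (Fin n) ℝ} {c : E n → ℝ}

theorem IsOpenConvexPolytope.isOpen (h : IsOpenConvexPolytope Ω) : IsOpen Ω := by
  obtain ⟨F, rfl⟩ := h
  exact isOpen_interior

theorem IsOpenConvexPolytope.isBounded (h : IsOpenConvexPolytope Ω) : Bornology.IsBounded Ω := by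
  obtain ⟨F, rfl⟩ := h
  exact ((isBounded_convexHull.2 F.finite_toSet.isBounded).subset interior_subset)

theorem norm_gradient (φ : E n → ℝ) (x : E n) : ‖gradient φ x‖ = ‖fderiv ℝ φ x‖ :=
  LinearIsometryEquiv.norm_map _ _

/-- Integration by parts against a coordinate function. -/
theorem integral_sq_eq_neg_integral_coord_mul (i : Fin n) {φ : E n → ℝ} (hφ : ContDiff ℝ ∞ φ)
    (hc : HasCompactSupport φ) :
    Integrable (fun x => x i * (2 * φ x * fderiv ℝ φ x (EuclideanSpace.single i 1))) ∧
    ∫ x, φ x ^ 2 = -∫ x, x i * (2 * φ x * fderiv ℝ φ x (EuclideanSpace.single i 1)) := by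
  have hd : Differentiable ℝ φ := hφ.differentiable (by simp)
  have hcont : Continuous φ := hφ.continuous
  have hcd : Continuous fun x => fderiv ℝ φ x := hφ.continuous_fderiv (by simp)
  have hX : Continuous fun x : E n => x i := by fun_prop
  have hXd : Differentiable ℝ fun x : E n => x i :=
    (EuclideanSpace.proj (𝕜 := ℝ) i : E n →L[ℝ] ℝ).differentiable
  have hXe : ∀ x, fderiv ℝ (fun x : E n => x i) x (EuclideanSpace.single i 1) = 1 := by
    intro x
    have h : HasFDerivAt (fun x : E n => x i) (EuclideanSpace.proj (𝕜 := ℝ) i : E n →L[ℝ] ℝ) x :=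
      (EuclideanSpace.proj (𝕜 := ℝ) i : E n →L[ℝ] ℝ).hasFDerivAt
    rw [h.fderiv]
    simp
  have hsq : ∀ x v, fderiv ℝ (fun y => φ y ^ 2) x v = 2 * φ x * fderiv ℝ φ x v := by
    intro x v
    rw [((hd x).hasFDerivAt.pow 2).fderiv]
    simp
  have hint : Integrable fun x => φ x ^ 2 :=
    (hcont.pow 2).integrable_of_hasCompactSupport
      (hc.mono fun x hx h => hx (by simp [h]))
  have hint' : Integrable fun x => x i * φ x ^ 2 :=
    (hX.mul (hcont.pow 2)).integrable_of_hasCompactSupport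
      (hc.mono fun x hx h => hx (by simp [h]))
  have hint3 : Integrable
      fun x => x i * (2 * φ x * fderiv ℝ φ x (EuclideanSpace.single i 1)) :=
    (hX.mul ((continuous_const.mul hcont).mul
      (hcd.clm_apply continuous_const))).integrable_of_hasCompactSupport
        (hc.mono fun x hx h => hx (by simp [h]))
  have hparts := integral_mul_fderiv_eq_neg_fderiv_mul_of_integrable (𝕜 := ℝ) (μ := volume)
    (f := fun x : E n => x i) (g := fun x => φ x ^ 2) (v := EuclideanSpace.single i 1)
    (by simpa only [hXe, one_mul] using hint) (by simpa only [hsq] using hint3)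
    hint' (fun x _ => hXd x) (fun x _ => (hd x).pow 2)
  simp only [hXe, one_mul, hsq] at hparts
  exact ⟨hint3, (neg_eq_iff_eq_neg.2 hparts).symm⟩

/-- Poincaré's inequality for smooth functions supported in a slab. -/
theorem integral_sq_le_of_slab (i : Fin n) {R : ℝ} {φ : E n → ℝ} (hφ : ContDiff ℝ ∞ φ)
    (hc : HasCompactSupport φ) (hR : ∀ x ∈ tsupport φ, |x i| ≤ R) :
    ∫ x, φ x ^ 2 ≤ 4 * R ^ 2 * ∫ x, ‖gradient φ x‖ ^ 2 := by
  simp_rw [norm_gradient]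
  obtain ⟨hint3, hparts⟩ := integral_sq_eq_neg_integral_coord_mul i hφ hc
  set e : E n := EuclideanSpace.single i 1 with he
  have hcd : Continuous fun x => fderiv ℝ φ x := hφ.continuous_fderiv (by simp)
  have hint2 : Integrable fun x => φ x ^ 2 :=
    (hφ.continuous.pow 2).integrable_of_hasCompactSupport
      (hc.mono fun x hx h => hx (by simp [h]))
  have hintg : Integrable fun x => ‖fderiv ℝ φ x‖ ^ 2 :=
    (hcd.norm.pow 2).integrable_of_hasCompactSupport
      ((hc.fderiv ℝ).mono fun x hx h => hx (by simp [h]))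
  have hpt : ∀ x, -(x i * (2 * φ x * fderiv ℝ φ x e)) ≤
      1 / 2 * φ x ^ 2 + 2 * R ^ 2 * ‖fderiv ℝ φ x‖ ^ 2 := by
    intro x
    have h1 : |fderiv ℝ φ x e| ≤ ‖fderiv ℝ φ x‖ := by
      have := (fderiv ℝ φ x).le_opNorm e
      simpa [he] using this
    by_cases hx : x ∈ tsupport φ
    · have h2 := hR x hx
      have h3 : (x i * fderiv ℝ φ x e) ^ 2 ≤ R ^ 2 * ‖fderiv ℝ φ x‖ ^ 2 := by
        rw [mul_pow, ← sq_abs (x i), ← sq_abs (fderiv ℝ φ x e)]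
        gcongr
      -- Young's inequality, weighted so that half of `∫ φ²` can be absorbed on the left.
      nlinarith [sq_nonneg (φ x + 2 * (x i * fderiv ℝ φ x e))]
    · rw [image_eq_zero_of_notMem_tsupport hx]
      have : 0 ≤ 2 * R ^ 2 * ‖fderiv ℝ φ x‖ ^ 2 := by positivity
      simpa using this
  have hfin : ∫ x, φ x ^ 2 ≤ ∫ x, (1 / 2 * φ x ^ 2 + 2 * R ^ 2 * ‖fderiv ℝ φ x‖ ^ 2) := by
    rw [hparts, ← integral_neg]
    exact integral_mono hint3.neg ((hint2.const_mul _).add (hintg.const_mul _)) hpt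
  rw [integral_add (hint2.const_mul _) (hintg.const_mul _), integral_const_mul,
    integral_const_mul] at hfin
  linarith

theorem norm_sq_eq_integral {F : Type*} [NormedAddCommGroup F] [InnerProductSpace ℝ F]
    {μ : Measure (E n)} (f : Lp F 2 μ) : ‖f‖ ^ 2 = ∫ x, ‖f x‖ ^ 2 ∂μ := by
  rw [← real_inner_self_eq_norm_sq, L2.inner_def]
  simp

/-- Poincaré's inequality on `H₀¹(Ω)`. -/
theorem exists_poincare (hn : 1 ≤ n) (hb : Bornology.IsBounded Ω) :
    ∃ C : ℝ, 0 < C ∧ ∀ p ∈ H10 Ω, ‖p.1‖ ≤ C * ‖p.2‖ := by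
  obtain ⟨R, hR0, hR⟩ := hb.exists_pos_norm_le
  refine ⟨2 * R, by positivity, fun p hp => ?_⟩
  -- The inequality is a closed condition, so test pairs suffice.
  have hcl : IsClosed {p : L2 Ω × L2Vec Ω | ‖p.1‖ ≤ 2 * R * ‖p.2‖} :=
    isClosed_le (by fun_prop) (by fun_prop)
  refine closure_minimal ?_ hcl hp
  rintro ⟨u, G⟩ ⟨φ, hφ, hc, hs, hu, hG⟩
  have h := integral_sq_le_of_slab ⟨0, hn⟩ hφ hc (R := R) fun x hx =>
    (PiLp.norm_apply_le x _).trans (hR x (hs hx))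
  have h1 : ‖u‖ ^ 2 = ∫ x, φ x ^ 2 := by
    rw [norm_sq_eq_integral,
      ← setIntegral_eq_integral_of_forall_compl_eq_zero (s := Ω) (f := fun x => φ x ^ 2)]
    · refine integral_congr_ae ?_
      filter_upwards [hu] with x hx
      rw [hx, Real.norm_eq_abs, sq_abs]
    · intro x hx
      simp [image_eq_zero_of_notMem_tsupport fun h => hx (hs h)]
  have h2 : ‖G‖ ^ 2 = ∫ x, ‖gradient φ x‖ ^ 2 := by
    rw [norm_sq_eq_integral,
      ← setIntegral_eq_integral_of_forall_compl_eq_zero (s := Ω) (f := fun x => ‖gradient φ x‖ ^ 2)]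
    · refine integral_congr_ae ?_
      filter_upwards [hG] with x hx
      rw [hx]
    · intro x hx
      have : fderiv ℝ φ x = 0 :=
        image_eq_zero_of_notMem_tsupport fun h => hx (hs (tsupport_fderiv_subset ℝ h))
      simp [norm_gradient, this]
  rw [← h1, ← h2] at h
  refine abs_le_of_sq_le_sq' (a := ‖u‖) (b := 2 * R * ‖G‖) ?_ (by positivity) |>.2
  linarith

theorem energyForm_comm (ho : IsOpen Ω) (hA : ∀ x ∈ Ω, (A x).IsSymm) (p q : L2 Ω × L2Vec Ω) :
    energyForm Ω A c p q = energyForm Ω A c q p := by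
  refine setIntegral_congr_fun ho.measurableSet fun x hx => ?_
  have h : ∀ i j, A x i j = A x j i := fun i j => ((hA x hx).apply i j).symm
  simp only
  congr 1
  · rw [Finset.sum_comm]
    refine Finset.sum_congr rfl fun j _ => Finset.sum_congr rfl fun i _ => ?_
    rw [h i j]; ring
  · ring

/-- Testing each eigenfunction equation with the other eigenfunction gives `(μ - η) ⟨ψ, φ⟩ = 0`;
orthogonality then passes to spans and closures. -/
theorem isOrtho_eigenspace (ho : IsOpen Ω) (hA : ∀ x ∈ Ω, (A x).IsSymm) {μ η : ℝ} (h : μ ≠ η) :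
    eigenspace Ω A c μ ⟂ eigenspace Ω A c η := by
  have key : Submodule.span ℝ {φ | IsEigenfunction Ω A c μ φ} ⟂
      Submodule.span ℝ {φ | IsEigenfunction Ω A c η φ} := by
    rw [Submodule.isOrtho_span]
    rintro φ ⟨G, hG, hφ⟩ ψ ⟨K, hK, hψ⟩
    have h1 := hφ _ hK
    have h2 := hψ _ hG
    rw [energyForm_comm ho hA, h1, real_inner_comm] at h2
    simp only at h2
    have h3 : (μ - η) * inner ℝ ψ φ = 0 := by linarith
    rw [real_inner_comm]
    exact (mul_eq_zero.1 h3).resolve_left (sub_ne_zero.2 h)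
  unfold eigenspace Submodule.IsOrtho
  rw [Submodule.orthogonal_closure]
  exact Submodule.topologicalClosure_minimal _ key (Submodule.isClosed_orthogonal _)

/-- The integrand of the energy form is integrable. -/
theorem integrable_energy (ho : IsOpen Ω) (hb : Bornology.IsBounded Ω)
    (hAc : IsEllipticCoeff Ω A c) (p q : L2 Ω × L2Vec Ω) :
    IntegrableOn (fun x => (∑ i, ∑ j, A x i j * p.2 x j * q.2 x i) + c x * p.1 x * q.1 x) Ω := by
  have hp2 : ∀ j, MemLp (fun x => p.2 x j) 2 (volume.restrict Ω) := fun j =>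
    (EuclideanSpace.proj (𝕜 := ℝ) j : E n →L[ℝ] ℝ).comp_memLp' (Lp.memLp p.2)
  have hq2 : ∀ j, MemLp (fun x => q.2 x j) 2 (volume.restrict Ω) := fun j =>
    (EuclideanSpace.proj (𝕜 := ℝ) j : E n →L[ℝ] ℝ).comp_memLp' (Lp.memLp q.2)
  have hA : ∀ i j, MemLp (fun x => A x i j) ∞ (volume.restrict Ω) := by
    intro i j
    obtain ⟨K, hK⟩ := hAc.lipschitz i j
    -- A globally Lipschitz extension maps the bounded set `Ω` to a bounded set.
    obtain ⟨g, hg, hgA⟩ := LipschitzOnWith.extend_real hK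
    obtain ⟨M, hM⟩ := (hg.isBounded_image hb).exists_norm_le
    refine memLp_top_of_bound (hK.continuousOn.aestronglyMeasurable ho.measurableSet) M ?_
    filter_upwards [ae_restrict_mem ho.measurableSet] with x hx
    exact hM _ ⟨x, hx, (hgA hx).symm⟩
  refine Integrable.add (integrable_finsetSum _ fun i _ => integrable_finsetSum _ fun j _ => ?_) ?_
  · exact ((hp2 j).mul (r := 2) (hA i j)).integrable_mul (hq2 i)
  · exact ((Lp.memLp p.1).mul (r := 2) hAc.bounded).integrable_mul (Lp.memLp q.1)

/-- Testing an eigenfunction with itself gives `α ‖∇φ‖² ≤ μ ‖φ‖²`, while Poincaré gives `‖φ‖² ≤ C²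
‖∇φ‖²`; hence `δ = α / C²`. -/
theorem exists_pos_le_of_eigenspace_ne_bot (hn : 1 ≤ n) (ho : IsOpen Ω) (hb : Bornology.IsBounded Ω)
    (hAc : IsEllipticCoeff Ω A c) :
    ∃ δ : ℝ, 0 < δ ∧ ∀ μ, eigenspace Ω A c μ ≠ ⊥ → δ ≤ μ := by
  obtain ⟨C, hC, hP⟩ := exists_poincare (Ω := Ω) hn hb
  obtain ⟨α, hα, hell⟩ := hAc.elliptic
  refine ⟨α / C ^ 2, by positivity, fun μ hμ => ?_⟩
  by_contra hlt
  refine hμ ?_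
  refine eq_bot_iff.2 (Submodule.topologicalClosure_minimal _ (Submodule.span_le.2 ?_)
    isClosed_singleton)
  · rintro φ ⟨G, hG, hφ⟩
    have h1 := hφ _ hG
    have h2 : α * ‖G‖ ^ 2 ≤ energyForm Ω A c (φ, G) (φ, G) := by
      rw [norm_sq_eq_integral, ← integral_const_mul]
      refine integral_mono_ae ?_ (integrable_energy ho hb hAc _ _) ?_
      · exact (Lp.memLp G).norm.integrable_sq.const_mul α
      · filter_upwards [ae_restrict_mem ho.measurableSet, hAc.nonneg] with x hx hcx
        have h3 := hell x hx (G x)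
        have h4 : 0 ≤ c x * (φ x * φ x) := mul_nonneg hcx (mul_self_nonneg _)
        linarith
    rw [h1, real_inner_self_eq_norm_sq] at h2
    have h5 : ‖φ‖ ^ 2 ≤ C ^ 2 * ‖G‖ ^ 2 := by
      rw [← mul_pow]
      exact pow_le_pow_left₀ (norm_nonneg _) (hP _ hG) 2
    have h6 : α / C ^ 2 * ‖φ‖ ^ 2 ≤ α * ‖G‖ ^ 2 := by
      rw [div_mul_eq_mul_div, div_le_iff₀ (by positivity)]
      nlinarith
    refine (Submodule.mem_bot ℝ).2 ?_
    by_contra hne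
    have h7 : 0 < ‖φ‖ ^ 2 := by
      have := norm_pos_iff.2 hne
      positivity
    nlinarith

end Elliptic

/-! ### Admissible controls and the reduced cost. -/

section Control

variable {n : ℕ} {Ω : Set (E n)}

/-- The constant function `t` in `L²(Ω)`. -/
noncomputable def constL2 (Ω : Set (E n)) [IsFiniteMeasure (volume.restrict Ω)] (t : ℝ) : L2 Ω :=
  Lp.const 2 (volume.restrict Ω) t

/-- Closedness then follows from that of order intervals in the Banach lattice L². -/
theorem admissible_eq_Icc [IsFiniteMeasure (volume.restrict Ω)] (a b : ℝ) :
    admissible Ω a b = Set.Icc (constL2 Ω a) (constL2 Ω b) := by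
  ext z
  have ha := Lp.coeFn_const (p := 2) (μ := volume.restrict Ω) a
  have hb := Lp.coeFn_const (p := 2) (μ := volume.restrict Ω) b
  rw [Set.mem_Icc, ← Lp.coeFn_le, ← Lp.coeFn_le]
  constructor
  · intro h
    constructor
    · filter_upwards [h, ha] with x hx h1
      exact h1.trans_le hx.1
    · filter_upwards [h, hb] with x hx h1
      exact hx.2.trans_eq h1.symm
  · rintro ⟨h1, h2⟩
    filter_upwards [h1, h2, ha, hb] with x h1 h2 h3 h4
    exact ⟨h3.symm.trans_le h1, h2.trans_eq h4⟩

theorem isClosed_admissible [IsFiniteMeasure (volume.restrict Ω)] (a b : ℝ) :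
    IsClosed (admissible Ω a b) := by
  rw [admissible_eq_Icc]
  exact isClosed_Icc

theorem midpoint_mem_admissible {a b : ℝ} {x y : L2 Ω} (hx : x ∈ admissible Ω a b)
    (hy : y ∈ admissible Ω a b) : (1 / 2 : ℝ) • (x + y) ∈ admissible Ω a b := by
  filter_upwards [hx, hy, Lp.coeFn_smul (1 / 2 : ℝ) (x + y), Lp.coeFn_add x y] with t h1 h2 h3 h4
  rw [h3, Pi.smul_apply, h4, Pi.add_apply, smul_eq_mul]
  constructor <;> linarith [h1.1, h1.2, h2.1, h2.2]

theorem zero_mem_admissible {a b : ℝ} (ha : a ≤ 0) (hb : 0 ≤ b) :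
    (0 : L2 Ω) ∈ admissible Ω a b := by
  filter_upwards [Lp.coeFn_zero ℝ 2 (volume.restrict Ω)] with x hx
  rw [hx]
  exact ⟨ha, hb⟩

theorem continuous_integral_abs [IsFiniteMeasure (volume.restrict Ω)] :
    Continuous fun z : L2 Ω => ∫ x in Ω, |z x| := by
  -- As a pairing with the constant 1, the L¹ norm inherits continuity from the lattice absolute
  -- value.
  have h : (fun z : L2 Ω => ∫ x in Ω, |z x|) = fun z => inner ℝ (constL2 Ω 1) |z| := by
    ext z
    rw [L2.inner_def]
    refine integral_congr_ae ?_
    filter_upwards [Lp.coeFn_const (p := 2) (μ := volume.restrict Ω) (1 : ℝ), Lp.coeFn_abs z]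
      with x h1 h2
    rw [constL2, h1, h2]
    simp
  rw [h]
  exact continuous_const.inner (continuous_id.sup continuous_neg)

theorem integral_abs_midpoint_le [IsFiniteMeasure (volume.restrict Ω)] (x y : L2 Ω) :
    ∫ t in Ω, |((1 / 2 : ℝ) • (x + y) : L2 Ω) t| ≤
      ((∫ t in Ω, |x t|) + ∫ t in Ω, |y t|) / 2 := by
  have hi : ∀ z : L2 Ω, Integrable (fun t => |z t|) (volume.restrict Ω) := fun z =>
    ((Lp.memLp z).integrable (by norm_num)).abs
  rw [← integral_add (hi x) (hi y), ← integral_div]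
  refine integral_mono_ae (hi _) (((hi x).add (hi y)).div_const 2) ?_
  filter_upwards [Lp.coeFn_smul (1 / 2 : ℝ) (x + y), Lp.coeFn_add x y] with t h3 h4
  rw [h3, Pi.smul_apply, h4, Pi.add_apply, smul_eq_mul, abs_mul, abs_of_pos (by norm_num)]
  linarith [abs_add_le (x t) (y t)]

/-- The reduced problem has a unique solution. -/
theorem existsUnique_reduced_minimizer [IsFiniteMeasure (volume.restrict Ω)]
    (S : L2 Ω →L[ℝ] L2 Ω) {a b σ ν : ℝ} (ha : a ≤ 0) (hb : 0 ≤ b) (hσ : 0 < σ) (hν : 0 ≤ ν)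
    (ud : L2 Ω) :
    ∃! z, z ∈ admissible Ω a b ∧
      ∀ y ∈ admissible Ω a b, cost Ω σ ν ud (S z) z ≤ cost Ω σ ν ud (S y) y := by
  have hpos : ∀ z : L2 Ω, 0 ≤ ∫ x in Ω, |z x| := fun z => integral_nonneg fun x => abs_nonneg _
  refine existsUnique_minimizer_of_midpoint ⟨0, zero_mem_admissible ha hb⟩
    (isClosed_admissible a b) (fun x hx y hy => midpoint_mem_admissible hx hy)
    -- The gap `σ / 8` is `σ / 2` times the parallelogram gap `1 / 4`.
    (j := fun z => cost Ω σ ν ud (S z) z) ?_ (fun z => ?_) (κ := σ / 8) (by positivity)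
    (fun x y => ?_)
  · unfold cost
    have := continuous_integral_abs (Ω := Ω)
    fun_prop
  · have := hpos z
    unfold cost
    positivity
  · have h1 := norm_sq_midpoint x y
    have h2 := norm_sq_midpoint (S x - ud) (S y - ud)
    have h3 : (1 / 2 : ℝ) • (S x - ud + (S y - ud)) = S ((1 / 2 : ℝ) • (x + y)) - ud := by
      rw [map_smul, map_add]
      module
    have h4 := mul_le_mul_of_nonneg_left (integral_abs_midpoint_le x y) hν
    rw [h3] at h2
    have h5 := sq_nonneg ‖S x - ud - (S y - ud)‖
    have h6 : σ / 2 * ‖(1 / 2 : ℝ) • (x + y)‖ ^ 2 + σ / 8 * ‖x - y‖ ^ 2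
        = σ / 2 * ((‖x‖ ^ 2 + ‖y‖ ^ 2) / 2) := by
      rw [← h1]; ring
    unfold cost
    linarith

end Control

/-! ### The control-to-state map. -/

section State

variable {n : ℕ} {Ω : Set (E n)} {A : E n → Matrix (Fin n) (Fin n) ℝ} {c : E n → ℝ}

/-- The fractional equation is uniquely solvable, with a bounded linear solution operator. -/
theorem exists_controlToState (hn : 1 ≤ n) (ho : IsOpen Ω) (hb : Bornology.IsBounded Ω)
    (hAc : IsEllipticCoeff Ω A c) {s : ℝ} (hs : 0 ≤ s) :
    ∃ S : L2 Ω →L[ℝ] L2 Ω, ∀ z u, IsState Ω A c s z u ↔ u = S z := by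
  obtain ⟨δ, hδ, hδle⟩ := exists_pos_le_of_eigenspace_ne_bot hn ho hb hAc
  exact exists_solutionOperator (V := fun μ : Set.Ioi (0 : ℝ) => eigenspace Ω A c μ)
    (m := fun μ => (μ : ℝ))
    (fun μ η h => isOrtho_eigenspace ho hAc.symm fun h' => h (Subtype.ext h'))
    (fun μ => μ.2) hδ (fun μ => hδle μ) hs

end State

end FracControl

theorem mainTheorem6 {n : ℕ} (hn : 1 ≤ n)
    (Ω : Set (FracControl.E n)) (hΩ : FracControl.IsOpenConvexPolytope Ω)
    (A : FracControl.E n → Matrix (Fin n) (Fin n) ℝ) (c : FracControl.E n → ℝ)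
    (hAc : FracControl.IsEllipticCoeff Ω A c)
    (s : ℝ) (hs0 : 0 < s) (hs1 : s < 1)
    (a b : ℝ) (ha : a < 0) (hb : 0 < b)
    (σ ν : ℝ) (hσ : 0 < σ) (hν : 0 < ν)
    (ud : FracControl.L2 Ω) :
    ∃! p : FracControl.L2 Ω × FracControl.L2 Ω,
      FracControl.IsOptimalPair Ω A c s a b σ ν ud p.1 p.2 := by
  have hb' := hΩ.isBounded
  have : IsFiniteMeasure (volume.restrict Ω) :=
    isFiniteMeasure_restrict.2 hb'.measure_lt_top.ne
  obtain ⟨S, hS⟩ := FracControl.exists_controlToState hn hΩ.isOpen hb' hAc hs0.le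
  obtain ⟨z, ⟨hz, hmin⟩, huniq⟩ :=
    FracControl.existsUnique_reduced_minimizer S ha.le hb.le hσ hν.le ud
  refine ⟨(S z, z), ⟨hz, (hS z _).2 rfl, fun u' z' hz' hu' => ?_⟩, ?_⟩
  · rw [(hS z' u').1 hu']
    exact hmin z' hz'
  · rintro ⟨u, y⟩ ⟨hy, hu, hopt⟩
    obtain rfl : u = S y := (hS y u).1 hu
    obtain rfl : y = z := huniq y ⟨hy, fun w hw => hopt (S w) w hw ((hS w _).2 rfl)⟩
    rfl
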